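/- Let $\Omega\subset\mathbb R^N$ ($N\ge 1$) be a bounded domain, $T>0$, $d>0$, $v\in\mathbb R^N$, and let $\mathcal L:L^2(\Omega)\to L^2(\Omega)$, $\mathcal L u_0=u(\cdot,T)$, be the (bounded linear) solution operator of $$\partial_t u-d\Delta u+v\cdot\nabla u=0 \text{ in } \Omega\times(0,T),\quad u=0\text{ on }\partial\Omega\times(0,T),\quad u(\cdot,0)=u_0 \text{ in }\Omega$$ (weak solutions $u\in C([0,T];L^2(\Omega))\cap L^2(0,T;H_0^1(\Omega))$), with adjoint $\mathcal L^*$. Let $u_T\in L^2(\Omega)$ and $\tau,\beta>0$, and set $$\varphi(u_0)=\beta\int_\Omega|u_0|\,dx,\quad g(u_0)=\tfrac\tau2\|u_0\|_{L^2(\Omega)}^2+\varphi(u_0),\quad f(q)=\tfrac12\|q-u_T\|_{L^2(\Omega)}^2,\quad f^*(p)=\sup_{q\in L^2(\Omega)}\big((p,q)-f(q)\big).$$ Let $w^*=(u_0^*,p^*)\in W:=L^2(\Omega)\times L^2(\Omega)$ be a saddle point of $$\min_{u_0\in L^2(\Omega)}\max_{p\in L^2(\Omega)}\ g(u_0)+(p,\mathcal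 L u_0)-f^*(p).$$ Let $r,s>0$ satisfy $rs\,\|\mathcal L\mathcal L^*\|<1$, let $\theta\in(0,1]$, and let $\rho,\sigma$ satisfy $\rho=\sigma\in(0,2)$ if $\theta=1$, and $\rho\in(0,\,1+\theta-\sqrt{1-\theta}\,]$, $\sigma=\rho/\theta$ if $\theta\in(0,1)$. From an arbitrary $w^0=(u_0^0,p^0)\in W$, let $w^k=(u_0^k,p^k)$ and $\tilde w^k=(\tilde u_0^k,\tilde p^k)$, $k\ge0$, be generated by $$\tilde u_0^k=\arg\min_{u_0\in L^2(\Omega)}\Big(g(u_0)+(p^k,\mathcal L u_0)+\tfrac1{2r}\|u_0-u_0^k\|^2\Big),\qquad \bar u_0^k=\tilde u_0^k+\theta(\tilde u_0^k-u_0^k),$$ $$\tilde p^k=\arg\max_{p\in L^2(\Omega)}\Big((p,\mathcal L\bar u_0^k)-f^*(p)-\tfrac1{2s}\|p-p^k\|^2\Big),$$ $$u_0^{k+1}=u_0^k-\rho(u_0^k-\tilde u_0^k),\qquad p^{k+1}=p^k-\sigma(p^k-\tilde p^k).$$ For $w=(u_0,p)\in W$ put $$F(w)=\begin{pmatrix}\tau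 u_0+\mathcal L^*p\\ p-\mathcal L u_0+u_T\end{pmatrix},\quad \mathcal D=\begin{pmatrix}\rho I&0\\0&\sigma I\end{pmatrix},\quad G=\begin{pmatrix}\frac1r I&-\mathcal L^*\\-\theta\mathcal L&\frac1s I\end{pmatrix},\quad \mathcal K=G\mathcal D^{-1},\quad \|w\|_{\mathcal K}^2=(\mathcal K w,w).$$ Then, for every integer $K\ge0$, with $w_K=\frac1{K+1}\sum_{k=0}^K\tilde w^k$ and $u_{0,K}=\frac1{K+1}\sum_{k=0}^K\tilde u_0^k$, $$\varphi(u_{0,K})-\varphi(u_0^*)+\big(w_K-w^*,F(w^*)\big)\le\frac1{2(K+1)}\|w^0-w^*\|_{\mathcal K}^2 .$$ -/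

import Mathlib

open MeasureTheory Set

noncomputable section

namespace SparseSource

/-- The Euclidean space `ℝ^N`. -/
abbrev E (N : ℕ) : Type := EuclideanSpace ℝ (Fin N)

/-- The real Hilbert space `L²(Ω)` (Lebesgue measure). -/
abbrev L2 {N : ℕ} (Ω : Set (E N)) : Type := Lp ℝ 2 ((volume : Measure (E N)).restrict Ω)

/-- The real Hilbert space `L²(Ω)^N` of square integrable vector fields on `Ω`. -/
abbrev L2Vec {N : ℕ} (Ω : Set (E N)) : Type :=
  Lp (E N) 2 ((volume : Measure (E N)).restrict Ω)

/-! ### The diffusion-advection equation -/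

/-- `φ` is a test function: a smooth real function with compact support contained in `Ω`. -/
structure IsTestFunction {N : ℕ} (Ω : Set (E N)) (φ : E N → ℝ) : Prop where
  smooth : ContDiff ℝ (⊤ : ℕ∞) φ
  compact : HasCompactSupport φ
  support_subset : tsupport φ ⊆ Ω

/-- `f` belongs to `H¹₀(Ω)` and `g` is its weak gradient: the pair `(f, g)` is a limit in
`L²(Ω) × L²(Ω)^N` of pairs `(φ, ∇φ)` with `φ` a test function, which says that `H¹₀(Ω)` is the
closure of the test functions in the `H¹`-norm. -/
def HasH10Gradient {N : ℕ} {Ω : Set (E N)} (f : L2 Ω) (g : L2Vec Ω) : Prop :=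
  (f, g) ∈ closure {q : L2 Ω × L2Vec Ω | ∃ φ : E N → ℝ, IsTestFunction Ω φ ∧
    (∀ᵐ x ∂(volume : Measure (E N)).restrict Ω, q.1 x = φ x) ∧
    (∀ᵐ x ∂(volume : Measure (E N)).restrict Ω, q.2 x = gradient φ x)}

/-- `u : [0,T] → L²(Ω)` is the weak solution of
`∂ₜu - d Δu + v·∇u = 0` in `Ω × (0,T)`, `u = 0` on `∂Ω × (0,T)`, `u(·,0) = u₀` in `Ω`:
it lies in `C([0,T]; L²(Ω)) ∩ L²(0,T; H¹₀(Ω))`, and for every test function `φ` and `t ∈ [0,T]`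
`(u(t), φ) - (u₀, φ) + ∫₀ᵗ (d (∇u(s), ∇φ) + (v·∇u(s), φ)) ds = 0`. -/
structure IsWeakSolution {N : ℕ} (Ω : Set (E N)) (T d : ℝ) (v : E N) (u₀ : L2 Ω)
    (u : ℝ → L2 Ω) : Prop where
  continuousOn : ContinuousOn u (Icc 0 T)
  initial : u 0 = u₀
  weak : ∃ G : ℝ → L2Vec Ω,
    MemLp G 2 ((volume : Measure ℝ).restrict (Ioc 0 T)) ∧
    (∀ᵐ t ∂(volume : Measure ℝ).restrict (Ioc 0 T), HasH10Gradient (u t) (G t)) ∧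
    ∀ φ : E N → ℝ, IsTestFunction Ω φ → ∀ t ∈ Icc (0 : ℝ) T,
      (∫ x in Ω, u t x * φ x) - (∫ x in Ω, u₀ x * φ x)
        + ∫ s in (0 : ℝ)..t,
            (∫ x in Ω, (d * inner ℝ (G s x) (gradient φ x) + inner ℝ v (G s x) * φ x)) = 0

/-- `L : L²(Ω) → L²(Ω)` is the solution operator `u₀ ↦ u(·,T)` of the diffusion-advection
equation. -/
def IsSolutionOperator {N : ℕ} (Ω : Set (E N)) (T d : ℝ) (v : E N) (L : L2 Ω →L[ℝ] L2 Ω) :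
    Prop :=
  ∀ u₀ : L2 Ω, ∃ u : ℝ → L2 Ω, IsWeakSolution Ω T d v u₀ u ∧ u T = L u₀

/-! ### The saddle point problem -/

/-- `φ(u) = β ∫_Ω |u| dx`. -/
def phi {N : ℕ} {Ω : Set (E N)} (β : ℝ) (u : L2 Ω) : ℝ := β * ∫ x in Ω, |u x|

/-- `g(u) = τ/2 ∫_Ω |u|² dx + β ∫_Ω |u| dx`. -/
def g {N : ℕ} {Ω : Set (E N)} (τ β : ℝ) (u : L2 Ω) : ℝ := τ / 2 * ‖u‖ ^ 2 + phi β u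

/-- `f(q) = 1/2 ∫_Ω |q - u_T|² dx`. -/
def f {N : ℕ} {Ω : Set (E N)} (uT q : L2 Ω) : ℝ := 1 / 2 * ‖q - uT‖ ^ 2

/-- The convex conjugate `f*(p) = sup_q ((p, q) - f(q))`. -/
def fConj {N : ℕ} {Ω : Set (E N)} (uT p : L2 Ω) : ℝ := ⨆ q : L2 Ω, (inner ℝ p q - f uT q)

/-- The supremum in the convex conjugate is a genuine (attained) one. -/
theorem fConj_isGreatest {N : ℕ} {Ω : Set (E N)} (uT p : L2 Ω) :
    IsGreatest (range fun q : L2 Ω => inner ℝ p q - f uT q) (fConj uT p) := by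
  have hg : IsGreatest (range fun q : L2 Ω => inner ℝ p q - f uT q)
      (1 / 2 * ‖p‖ ^ 2 + inner ℝ p uT) := by
    constructor
    · refine ⟨p + uT, ?_⟩
      simp only [f, inner_add_right, real_inner_self_eq_norm_sq, add_sub_cancel_right]
      ring
    · rintro _ ⟨q, rfl⟩
      have h := norm_sub_sq_real p (q - uT)
      have h0 := sq_nonneg ‖p - (q - uT)‖
      rw [inner_sub_right] at h
      simp only [f]
      linarith
  have h : fConj uT p = 1 / 2 * ‖p‖ ^ 2 + inner ℝ p uT := hg.csSup_eq
  rw [h]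
  exact hg

/-- The space `W = L²(Ω) × L²(Ω)` with the Hilbert product structure. -/
abbrev W {N : ℕ} (Ω : Set (E N)) : Type := WithLp 2 (L2 Ω × L2 Ω)

/-- The function `g(u) + (p, L u) - f*(p)` whose saddle points are sought. -/
def lagrangian {N : ℕ} {Ω : Set (E N)} (τ β : ℝ) (uT : L2 Ω) (L : L2 Ω →L[ℝ] L2 Ω)
    (u p : L2 Ω) : ℝ :=
  g τ β u + inner ℝ p (L u) - fConj uT p

/-- `w = (u, p)` solves `min_u max_p (g(u) + (p, L u) - f*(p))`, i.e. it is a saddle point. -/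
def IsSaddlePoint {N : ℕ} {Ω : Set (E N)} (τ β : ℝ) (uT : L2 Ω) (L : L2 Ω →L[ℝ] L2 Ω)
    (w : W Ω) : Prop :=
  (∀ p : L2 Ω, lagrangian τ β uT L w.fst p ≤ lagrangian τ β uT L w.fst w.snd) ∧
  (∀ u : L2 Ω, lagrangian τ β uT L w.fst w.snd ≤ lagrangian τ β uT L u w.snd)

/-! ### The generalized primal-dual algorithm -/

/-- The admissible relaxation parameters. -/
def AdmissibleRelaxation (θ ρ σ : ℝ) : Prop :=
  (θ = 1 ∧ ρ = σ ∧ ρ ∈ Ioo (0 : ℝ) 2) ∨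
  (θ ∈ Ioo (0 : ℝ) 1 ∧ ρ ∈ Ioc (0 : ℝ) (1 + θ - √(1 - θ)) ∧ σ = ρ / θ)

/-- `w k = (u₀^k, p^k)` and `w' k = (ũ₀^k, p̃^k)` are the iterates and the predictors generated by
the generalized primal-dual algorithm (from the arbitrary initial value `w 0`). -/
structure IsAlgorithmRun {N : ℕ} {Ω : Set (E N)} (τ β : ℝ) (uT : L2 Ω) (L : L2 Ω →L[ℝ] L2 Ω)
    (θ r s ρ σ : ℝ) (w w' : ℕ → W Ω) : Prop where
  predict_u : ∀ k, IsMinOn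
    (fun u : L2 Ω => g τ β u + inner ℝ (w k).snd (L u) + 1 / (2 * r) * ‖u - (w k).fst‖ ^ 2)
    univ (w' k).fst
  predict_p : ∀ k, IsMaxOn
    (fun p : L2 Ω => inner ℝ p (L ((w' k).fst + θ • ((w' k).fst - (w k).fst)))
      - fConj uT p - 1 / (2 * s) * ‖p - (w k).snd‖ ^ 2)
    univ (w' k).snd
  correct_u : ∀ k, (w (k + 1)).fst = (w k).fst - ρ • ((w k).fst - (w' k).fst)
  correct_p : ∀ k, (w (k + 1)).snd = (w k).snd - σ • ((w k).snd - (w' k).snd)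

/-! ### The operators of the convergence analysis -/

/-- `F(u, p) = (τ u + L* p, p - L u + u_T)`. -/
def opF {N : ℕ} {Ω : Set (E N)} (τ : ℝ) (uT : L2 Ω) (L : L2 Ω →L[ℝ] L2 Ω) (w : W Ω) : W Ω :=
  WithLp.toLp 2 (τ • w.fst + L.adjoint w.snd, w.snd - L w.fst + uT)

/-- `D = diag(ρ I, σ I)`. -/
def opD {N : ℕ} {Ω : Set (E N)} (ρ σ : ℝ) (w : W Ω) : W Ω :=
  WithLp.toLp 2 (ρ • w.fst, σ • w.snd)

/-- `G (u, p) = ((1/r) u - L* p, -θ L u + (1/s) p)`. -/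
def opG {N : ℕ} {Ω : Set (E N)} (L : L2 Ω →L[ℝ] L2 Ω) (θ r s : ℝ) (w : W Ω) : W Ω :=
  WithLp.toLp 2 ((1 / r) • w.fst - L.adjoint w.snd, -(θ • L w.fst) + (1 / s) • w.snd)

/-- `K = G D⁻¹`, where `D⁻¹ = diag(ρ⁻¹ I, σ⁻¹ I)`. -/
def opK {N : ℕ} {Ω : Set (E N)} (L : L2 Ω →L[ℝ] L2 Ω) (θ r s ρ σ : ℝ) (w : W Ω) : W Ω :=
  opG L θ r s (opD ρ⁻¹ σ⁻¹ w)

/-- `‖w‖_K² = (K w, w)`. -/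
def normSqK {N : ℕ} {Ω : Set (E N)} (L : L2 Ω →L[ℝ] L2 Ω) (θ r s ρ σ : ℝ) (w : W Ω) : ℝ :=
  inner ℝ (opK L θ r s ρ σ w) w

end SparseSource

end

/-! The optimality conditions of the two proximal steps combine, for every `z`, into `φ(ũ) - φ(u) +
(w̃ - z, F w̃) ≤ (w̃ - z, G (wᵏ - w̃))`. The operator part of `F` is skew, so `F` is monotone and `F
w̃` may be replaced by `F z`. Since `wᵏ⁺¹ = wᵏ - D (wᵏ - w̃)` and `K D = G` with `K` symmetric, the
right side is half the decrease of `‖· - z‖_K²`, minus half the quadratic form of `G + G* - D K D`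
at `wᵏ - w̃`. The relaxation bounds make that form nonnegative, which gives `IsAlgorithmRun.gap_le`.
Telescoping, `K ≥ 0` and Jensen's inequality for `φ` give the averaged rate. -/

/-- First order optimality for the sum of a convex function and a quadratic one. -/
theorem ConvexOn.le_add_inner_of_isMinOn {H : Type*} [NormedAddCommGroup H]
    [InnerProductSpace ℝ H] {h : H → ℝ} (hh : ConvexOn ℝ Set.univ h) (τ c : ℝ) (q u₀ ut : H)
    (hmin : IsMinOn (fun u => h u + τ / 2 * ‖u‖ ^ 2 + inner ℝ q u + c / 2 * ‖u - u₀‖ ^ 2)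
      Set.univ ut) (u : H) :
    h ut ≤ h u + inner ℝ (u - ut) (τ • ut + q + c • (ut - u₀)) := by
  set A : ℝ := h u - h ut + inner ℝ (u - ut) (τ • ut + q + c • (ut - u₀)) with hA
  set B : ℝ := (τ + c) / 2 * ‖u - ut‖ ^ 2 with hB
  -- Compare `ut` with `ut + t (u - ut)` and divide by `t`; only the remainder `t * B` survives, and
  -- it vanishes as `t → 0⁺`.
  have key : ∀ t : ℝ, 0 < t → t ≤ 1 → 0 ≤ A + t * B := by
    intro t ht ht1
    have h1 := isMinOn_iff.1 hmin (ut + t • (u - ut)) (Set.mem_univ _)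
    have h2 := hh.2 (Set.mem_univ ut) (Set.mem_univ u) (sub_nonneg.2 ht1) ht.le (by ring)
    have h3 : (1 - t) • ut + t • u = ut + t • (u - ut) := by module
    have h4 : ut + t • (u - ut) - u₀ = (ut - u₀) + t • (u - ut) := by module
    rw [h3, smul_eq_mul, smul_eq_mul] at h2
    simp only [h4, norm_add_sq_real, norm_smul, mul_pow, inner_add_right, inner_smul_right,
      Real.norm_eq_abs, sq_abs] at h1
    have h5 : 0 ≤ t * (A + t * B) := by
      simp only [hA, hB, inner_add_right, inner_smul_right, real_inner_comm q (u - ut),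
        real_inner_comm ut (u - ut), real_inner_comm (ut - u₀) (u - ut)]
      linarith [h1, h2]
    exact nonneg_of_mul_nonneg_right h5 ht
  have hlim : Filter.Tendsto (fun t : ℝ => A + t * B) (nhdsWithin 0 (Set.Ioi 0)) (nhds A) := by
    have : Filter.Tendsto (fun t : ℝ => A + t * B) (nhds 0) (nhds (A + 0 * B)) :=
      Continuous.tendsto (by fun_prop) 0
    simpa using this.mono_left nhdsWithin_le_nhds
  have hA0 : 0 ≤ A := by
    refine ge_of_tendsto hlim ?_
    filter_upwards [Ioc_mem_nhdsGT (zero_lt_one' ℝ)] with t ht using key t ht.1 ht.2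
  linarith

/-- The block quadratic form `a|u|² - 2c(Lu, p) + b|p|²` is nonnegative when `c² ≤ a b r s` and
`r s |L|² ≤ 1`. -/
theorem quadratic_block_nonneg {H : Type*} [NormedAddCommGroup H] [InnerProductSpace ℝ H]
    (L : H →L[ℝ] H) {r s a b c : ℝ} (hrs : r * s * ‖L‖ ^ 2 ≤ 1)
    (ha : 0 ≤ a) (hb : 0 ≤ b) (hc : c ^ 2 ≤ a * b * (r * s)) (u p : H) :
    0 ≤ a * ‖u‖ ^ 2 - 2 * c * inner ℝ (L u) p + b * ‖p‖ ^ 2 := by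
  have h1 : |inner ℝ (L u) p| ≤ ‖L‖ * ‖u‖ * ‖p‖ :=
    (abs_real_inner_le_norm _ _).trans (by gcongr; exact L.le_opNorm u)
  have h2 : (c * ‖L‖) ^ 2 ≤ a * b := by
    calc (c * ‖L‖) ^ 2 = c ^ 2 * ‖L‖ ^ 2 := by ring
      _ ≤ a * b * (r * s) * ‖L‖ ^ 2 := by gcongr
      _ = a * b * (r * s * ‖L‖ ^ 2) := by ring
      _ ≤ a * b * 1 := by gcongr
      _ = a * b := mul_one _
  have h3 : |c * ‖L‖| ≤ √a * √b := by
    rw [← Real.sqrt_mul ha]; exact Real.abs_le_sqrt h2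
  have h4 : c * inner ℝ (L u) p ≤ √a * √b * (‖u‖ * ‖p‖) := by
    calc c * inner ℝ (L u) p ≤ |c| * |inner ℝ (L u) p| := by
          rw [← abs_mul]; exact le_abs_self _
      _ ≤ |c| * (‖L‖ * ‖u‖ * ‖p‖) := by gcongr
      _ = |c * ‖L‖| * (‖u‖ * ‖p‖) := by rw [abs_mul, abs_norm]; ring
      _ ≤ _ := by gcongr
  have h5 : (√a * ‖u‖ - √b * ‖p‖) ^ 2
      = a * ‖u‖ ^ 2 - 2 * (√a * √b * (‖u‖ * ‖p‖)) + b * ‖p‖ ^ 2 := by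
    rw [sub_sq, mul_pow, mul_pow, Real.sq_sqrt ha, Real.sq_sqrt hb]; ring
  nlinarith [sq_nonneg (√a * ‖u‖ - √b * ‖p‖)]

namespace SparseSource

/-- The properties of the relaxation parameters that make `K` symmetric and nonnegative and the
correction step contractive. -/
theorem AdmissibleRelaxation.bounds {θ ρ σ : ℝ} (h : AdmissibleRelaxation θ ρ σ) :
    0 < ρ ∧ ρ ≤ σ ∧ ρ = θ * σ ∧ ρ ≤ 2 ∧ σ ≤ 2 ∧ (1 + θ - ρ) ^ 2 ≤ (2 - ρ) * (2 - σ) := by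
  rcases h with ⟨rfl, rfl, h0, h2⟩ | ⟨⟨h0, h1⟩, ⟨hρ0, hρ⟩, rfl⟩
  · exact ⟨h0, le_rfl, by ring, h2.le, h2.le, le_of_eq (by ring)⟩
  · have hx : 1 - θ ≤ (1 + θ - ρ) ^ 2 := by
      have := Real.sq_sqrt (sub_nonneg.2 h1.le)
      nlinarith [Real.sqrt_nonneg (1 - θ)]
    have hρ2 : ρ < 2 := by linarith [Real.sqrt_nonneg (1 - θ)]
    have hm : ρ = θ * (ρ / θ) := by field_simp
    have hprod : (1 + θ - ρ) ^ 2 ≤ (2 - ρ) * (2 - ρ / θ) := by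
      refine le_of_mul_le_mul_left ?_ h0
      have : θ * ((2 - ρ) * (2 - ρ / θ)) = (2 - ρ) * (2 * θ - ρ) := by
        linear_combination (2 - ρ) * hm
      rw [this]
      -- With `x = 1 + θ - ρ`, the right side is `(x + (1 - θ)) (x - (1 - θ))`, so the claim reduces
      -- to `1 - θ ≤ x ^ 2`, which is `hx`.
      nlinarith
    refine ⟨hρ0, ?_, hm, hρ2.le, ?_, hprod⟩
    · rw [le_div_iff₀ h0]; nlinarith
    · have := nonneg_of_mul_nonneg_right ((sq_nonneg _).trans hprod) (sub_pos.2 hρ2)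
      linarith

variable {N : ℕ} {Ω : Set (E N)}

theorem fConj_eq (uT p : L2 Ω) : fConj uT p = 1 / 2 * ‖p‖ ^ 2 + inner ℝ p uT := by
  refine (fConj_isGreatest uT p).unique ⟨⟨p + uT, ?_⟩, ?_⟩
  · simp only [f, inner_add_right, real_inner_self_eq_norm_sq, add_sub_cancel_right]
    ring
  · rintro _ ⟨q, rfl⟩
    have h := norm_sub_sq_real p (q - uT)
    have h0 := sq_nonneg ‖p - (q - uT)‖
    rw [inner_sub_right] at h
    simp only [f]
    linarith

/-- Finite measure gives `L² ⊆ L¹`, so the integral in `phi` never takes its default value `0`. -/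
theorem integrable_of_isBounded (hΩ : Bornology.IsBounded Ω) (u : L2 Ω) :
    Integrable u ((volume : Measure (E N)).restrict Ω) := by
  have : IsFiniteMeasure ((volume : Measure (E N)).restrict Ω) :=
    isFiniteMeasure_restrict.2 hΩ.measure_lt_top.ne
  exact (Lp.memLp u).integrable (by norm_num)

theorem convexOn_phi (hΩ : Bornology.IsBounded Ω) {β : ℝ} (hβ : 0 ≤ β) :
    ConvexOn ℝ univ (phi β : L2 Ω → ℝ) := by
  refine ⟨convex_univ, fun x _ y _ a b ha hb _ => ?_⟩
  have hx := (integrable_of_isBounded hΩ x).abs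
  have hy := (integrable_of_isBounded hΩ y).abs
  have hle : ∫ z in Ω, |(a • x + b • y : L2 Ω) z| ≤ ∫ z in Ω, (a * |x z| + b * |y z|) := by
    refine integral_mono_ae (integrable_of_isBounded hΩ _).abs
      ((hx.const_mul a).add (hy.const_mul b)) ?_
    filter_upwards [Lp.coeFn_add (a • x) (b • y), Lp.coeFn_smul a x, Lp.coeFn_smul b y]
      with z h1 h2 h3
    simp only [h1, Pi.add_apply, h2, h3, Pi.smul_apply, smul_eq_mul]
    refine (abs_add_le _ _).trans_eq ?_
    rw [abs_mul, abs_mul, abs_of_nonneg ha, abs_of_nonneg hb]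
  rw [integral_add (hx.const_mul a) (hy.const_mul b), integral_const_mul,
    integral_const_mul] at hle
  calc phi β (a • x + b • y) ≤ β * (a * (∫ z in Ω, |x z|) + b * ∫ z in Ω, |y z|) :=
        mul_le_mul_of_nonneg_left hle hβ
    _ = a • phi β x + b • phi β y := by simp only [phi, smul_eq_mul]; ring

theorem inner_eq_fst_add_snd (w z : W Ω) :
    inner ℝ w z = inner ℝ w.fst z.fst + inner ℝ w.snd z.snd := rfl

/-- The relation `ρ = θ σ` makes the two off-diagonal blocks of `K` adjoint to each other, so they
merge into one cross term. -/
theorem normSqK_eq (L : L2 Ω →L[ℝ] L2 Ω) {θ r s ρ σ : ℝ} (hσ : σ ≠ 0) (hρ : ρ ≠ 0)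
    (hρσ : ρ = θ * σ) (w : W Ω) :
    normSqK L θ r s ρ σ w = 1 / (r * ρ) * ‖w.fst‖ ^ 2 - 2 * σ⁻¹ * inner ℝ (L w.fst) w.snd
      + 1 / (s * σ) * ‖w.snd‖ ^ 2 := by
  have hθ : θ * ρ⁻¹ = σ⁻¹ := by rw [hρσ] at hρ ⊢; field_simp [left_ne_zero_of_mul hρ]
  simp only [normSqK, opK, opG, opD, inner_eq_fst_add_snd, inner_add_left, inner_sub_left,
    inner_neg_left, inner_smul_left, map_smul, ContinuousLinearMap.adjoint_inner_left,
    real_inner_self_eq_norm_sq, conj_trivial, WithLp.toLp_fst, WithLp.toLp_snd]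
  rw [real_inner_comm]
  simp only [one_div, mul_inv]
  linear_combination (-inner ℝ (L w.fst) w.snd) * hθ

/-! ### One-step estimate for the algorithm -/

variable {τ β θ r s ρ σ : ℝ} {uT : L2 Ω} {L : L2 Ω →L[ℝ] L2 Ω} {w w' : ℕ → W Ω}

theorem IsAlgorithmRun.phi_predict_le (hw : IsAlgorithmRun τ β uT L θ r s ρ σ w w')
    (hΩ : Bornology.IsBounded Ω) (hβ : 0 ≤ β) (k : ℕ) (u : L2 Ω) :
    phi β (w' k).fst ≤ phi β u + inner ℝ (u - (w' k).fst)
      (τ • (w' k).fst + L.adjoint (w k).snd + (1 / r) • ((w' k).fst - (w k).fst)) := by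
  refine (convexOn_phi hΩ hβ).le_add_inner_of_isMinOn τ (1 / r) _ _ _ ?_ u
  convert hw.predict_u k using 2 with u
  rw [ContinuousLinearMap.adjoint_inner_left, g]
  ring

theorem IsAlgorithmRun.inner_predict_nonneg (hw : IsAlgorithmRun τ β uT L θ r s ρ σ w w')
    (k : ℕ) (p : L2 Ω) :
    0 ≤ inner ℝ (p - (w' k).snd) ((w' k).snd
      + (uT - L ((w' k).fst + θ • ((w' k).fst - (w k).fst)))
      + (1 / s) • ((w' k).snd - (w k).snd)) := by
  -- The conjugate is an explicit quadratic, so the negated dual objective has zero nonsmooth part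
  -- and curvature `1`.
  have h := (convexOn_const (0 : ℝ) convex_univ).le_add_inner_of_isMinOn 1 (1 / s)
    (uT - L ((w' k).fst + θ • ((w' k).fst - (w k).fst))) (w k).snd (w' k).snd ?_ p
  · simpa using h
  · refine isMinOn_iff.2 fun x _ => ?_
    have hx := isMaxOn_iff.1 (hw.predict_p k) x (mem_univ x)
    simp only [fConj_eq] at hx
    rw [real_inner_comm x, real_inner_comm (w' k).snd, inner_sub_right, inner_sub_right]
    have e : 1 / s / 2 = 1 / (2 * s) := by rw [div_div, mul_comm]
    rw [e]
    linarith

/-- One step of the algorithm: the gap at the predictor is bounded by the decrease of the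
`K`-norm distance. -/
theorem IsAlgorithmRun.gap_le (hw : IsAlgorithmRun τ β uT L θ r s ρ σ w w')
    (hΩ : Bornology.IsBounded Ω) (hτ : 0 ≤ τ) (hβ : 0 ≤ β) (hr : 0 < r) (hs : 0 < s)
    (hrs : r * s * ‖L‖ ^ 2 ≤ 1) (hrelax : AdmissibleRelaxation θ ρ σ) (k : ℕ) (z : W Ω) :
    phi β (w' k).fst - phi β z.fst + inner ℝ (w' k - z) (opF τ uT L z)
      ≤ 1 / 2 * (normSqK L θ r s ρ σ (w k - z) - normSqK L θ r s ρ σ (w (k + 1) - z)) := by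
  obtain ⟨hρ0, hρσ, hθ, hρ2, hσ2, hprod⟩ := hrelax.bounds
  have hσ0 : 0 < σ := hρ0.trans_le hρσ
  rw [normSqK_eq L hσ0.ne' hρ0.ne' hθ, normSqK_eq L hσ0.ne' hρ0.ne' hθ]
  have h1 := hw.phi_predict_le hΩ hβ k z.fst
  have h2 := hw.inner_predict_nonneg k z.snd
  have e1 : (w (k + 1) - z).fst = ((w k).fst - z.fst) - ρ • ((w k).fst - (w' k).fst) := by
    rw [WithLp.sub_fst, hw.correct_u]; abel
  have e2 : (w (k + 1) - z).snd = ((w k).snd - z.snd) - σ • ((w k).snd - (w' k).snd) := by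
    rw [WithLp.sub_snd, hw.correct_p]; abel
  rw [e1, e2, WithLp.sub_fst, WithLp.sub_snd, inner_eq_fst_add_snd, WithLp.sub_fst, WithLp.sub_snd]
  simp only [opF, WithLp.toLp_fst, WithLp.toLp_snd]
  generalize (w k).fst = uk at *
  generalize (w k).snd = pk at *
  generalize (w' k).fst = ut at *
  generalize (w' k).snd = pt at *
  generalize z.fst = u at *
  generalize z.snd = p at *
  -- Coordinates: `(a, b) = wᵏ - z` and `(m, n) = wᵏ - w̃ᵏ`.
  obtain ⟨a, rfl⟩ : ∃ a, uk = u + a := ⟨uk - u, by abel⟩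
  obtain ⟨b, rfl⟩ : ∃ b, pk = p + b := ⟨pk - p, by abel⟩
  obtain ⟨m, rfl⟩ : ∃ m, ut = u + a - m := ⟨u + a - ut, by abel⟩
  obtain ⟨n, rfl⟩ : ∃ n, pt = p + b - n := ⟨p + b - pt, by abel⟩
  -- The form of `G + G* - D K D` at `(m, n)`.
  have h3 : 0 ≤ (2 - ρ) / r * ‖m‖ ^ 2 - 2 * (1 + θ - ρ) * inner ℝ (L m) n
      + (2 - σ) / s * ‖n‖ ^ 2 := by
    refine quadratic_block_nonneg L hrs (by have := sub_nonneg.2 hρ2; positivity)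
      (by have := sub_nonneg.2 hσ2; positivity) (hprod.trans_eq ?_) m n
    field_simp
  -- Monotonicity of `F` between `w̃ᵏ` and `z`.
  have h4 : 0 ≤ τ * ‖a - m‖ ^ 2 + ‖b - n‖ ^ 2 := by positivity
  -- With `x = (a, b)` and `y = (m, n)`: `‖x‖_K² - ‖x - D y‖_K² = 2 (x, G y) - (D K D y, y)`.
  have e3 : 1 / (r * ρ) * ‖a‖ ^ 2 - 2 * σ⁻¹ * inner ℝ (L a) b + 1 / (s * σ) * ‖b‖ ^ 2
      - (1 / (r * ρ) * ‖a - ρ • m‖ ^ 2 - 2 * σ⁻¹ * inner ℝ (L (a - ρ • m)) (b - σ • n)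
        + 1 / (s * σ) * ‖b - σ • n‖ ^ 2)
      = 1 / r * (2 * inner ℝ a m - ρ * ‖m‖ ^ 2)
        - 2 * (inner ℝ (L a) n + θ * inner ℝ (L m) b - ρ * inner ℝ (L m) n)
        + 1 / s * (2 * inner ℝ b n - σ * ‖n‖ ^ 2) := by
    simp only [norm_sub_sq_real, norm_smul, mul_pow, Real.norm_eq_abs, sq_abs, map_sub, map_smul,
      inner_sub_left, inner_sub_right, inner_smul_left, inner_smul_right, conj_trivial]
    have hσ' : σ ≠ 0 := hσ0.ne'
    have hθ0 : θ ≠ 0 := left_ne_zero_of_mul (hθ ▸ hρ0.ne')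
    rw [hθ]
    field_simp
    ring
  have s1 : u + a - m - (u + a) = -m := by abel
  have s2 : p + b - n - (p + b) = -n := by abel
  have s3 : u - (u + a - m) = m - a := by abel
  have s4 : p - (p + b - n) = n - b := by abel
  have s5 : u + a - m - u = a - m := by abel
  have s6 : p + b - n - p = b - n := by abel
  have s7 : u + a - u = a := by abel
  have s8 : p + b - p = b := by abel
  have s9 : u + a - (u + a - m) = m := by abel
  have s10 : p + b - (p + b - n) = n := by abel
  simp only [s1, s2, s3, s4, s5, s6, s7, s8, s9, s10] at h1 h2 ⊢
  rw [e3]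
  simp only [norm_sub_sq_real, map_add, map_sub, map_neg, map_smul, smul_neg, smul_add, smul_sub,
    inner_add_right, inner_sub_left, inner_sub_right, inner_neg_right, inner_smul_right,
    ContinuousLinearMap.adjoint_inner_right, real_inner_self_eq_norm_sq,
    real_inner_comm a m, real_inner_comm b n, real_inner_comm u, real_inner_comm p,
    real_inner_comm uT, fun x y : L2 Ω => real_inner_comm x (L y)] at h1 h2 h3 h4 ⊢
  simp only [div_eq_mul_inv, one_mul] at h1 h2 h3 h4 ⊢
  linarith

end SparseSource

/-! ### Telescoping and averaging -/

open SparseSource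

theorem mainTheorem3 {N : ℕ} (hN : 1 ≤ N)
    (Ω : Set (SparseSource.E N)) (hΩ_open : IsOpen Ω) (hΩ_conn : IsConnected Ω)
    (hΩ_bdd : Bornology.IsBounded Ω)
    (T d : ℝ) (hT : 0 < T) (hd : 0 < d) (v : SparseSource.E N)
    (L : SparseSource.L2 Ω →L[ℝ] SparseSource.L2 Ω)
    (hL : SparseSource.IsSolutionOperator Ω T d v L)
    (uT : SparseSource.L2 Ω) (τ β : ℝ) (hτ : 0 < τ) (hβ : 0 < β)
    (θ r s ρ σ : ℝ) (hr : 0 < r) (hs : 0 < s)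
    (hrs : r * s * ‖L.comp L.adjoint‖ < 1)
    (hrelax : SparseSource.AdmissibleRelaxation θ ρ σ)
    (w w' : ℕ → SparseSource.W Ω)
    (hw : SparseSource.IsAlgorithmRun τ β uT L θ r s ρ σ w w')
    (wstar : SparseSource.W Ω)
    (hwstar : SparseSource.IsSaddlePoint τ β uT L wstar)
    (K : ℕ) (wK : SparseSource.W Ω) (uK : SparseSource.L2 Ω)
    (hwK : wK = (1 / ((K : ℝ) + 1)) • ∑ k ∈ Finset.range (K + 1), w' k)
    (huK : uK = (1 / ((K : ℝ) + 1)) • ∑ k ∈ Finset.range (K + 1), (w' k).fst) :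
    SparseSource.phi β uK - SparseSource.phi β wstar.fst
        + inner ℝ (wK - wstar) (SparseSource.opF τ uT L wstar)
      ≤ 1 / (2 * ((K : ℝ) + 1)) * SparseSource.normSqK L θ r s ρ σ (w 0 - wstar) := by
  have hrs' : r * s * ‖L‖ ^ 2 ≤ 1 := by
    have h := ContinuousLinearMap.norm_adjoint_comp_self L.adjoint
    rw [ContinuousLinearMap.adjoint_adjoint, LinearIsometryEquiv.norm_map] at h
    rw [h] at hrs
    linarith
  obtain ⟨hρ0, hρσ, hθ, -, -, -⟩ := hrelax.bounds
  have hσ0 : 0 < σ := hρ0.trans_le hρσ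
  have hpos : 0 ≤ normSqK L θ r s ρ σ (w (K + 1) - wstar) := by
    rw [normSqK_eq L hσ0.ne' hρ0.ne' hθ]
    refine quadratic_block_nonneg L hrs' (by positivity) (by positivity) ?_ _ _
    -- Nonnegativity of `K` reduces to `σ⁻¹ * σ⁻¹ ≤ ρ⁻¹ * σ⁻¹`, that is, to `ρ ≤ σ`.
    have e : 1 / (r * ρ) * (1 / (s * σ)) * (r * s) = ρ⁻¹ * σ⁻¹ := by field_simp
    rw [e, sq]
    gcongr
  have hsum : ∑ k ∈ Finset.range (K + 1), (phi β (w' k).fst - phi β wstar.fst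
      + inner ℝ (w' k - wstar) (opF τ uT L wstar))
      ≤ 1 / 2 * normSqK L θ r s ρ σ (w 0 - wstar) := by
    refine (Finset.sum_le_sum fun k _ =>
      hw.gap_le hΩ_bdd hτ.le hβ.le hr hs hrs' hrelax k wstar).trans ?_
    rw [← Finset.mul_sum, Finset.sum_range_sub']
    linarith
  have hK : (0 : ℝ) < (K : ℝ) + 1 := by positivity
  have hjensen : phi β uK ≤ 1 / ((K : ℝ) + 1) * ∑ k ∈ Finset.range (K + 1), phi β (w' k).fst := by
    rw [huK, Finset.smul_sum, Finset.mul_sum]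
    refine (convexOn_phi hΩ_bdd hβ.le).map_sum_le (fun _ _ => by positivity) ?_
      fun _ _ => Set.mem_univ _
    simp only [Finset.sum_const, Finset.card_range, nsmul_eq_mul, Nat.cast_add, Nat.cast_one]
    field_simp
  have hinner : inner ℝ (wK - wstar) (opF τ uT L wstar) = 1 / ((K : ℝ) + 1)
      * ∑ k ∈ Finset.range (K + 1), inner ℝ (w' k - wstar) (opF τ uT L wstar) := by
    rw [← sum_inner, Finset.sum_sub_distrib, ← real_inner_smul_left, smul_sub, ← hwK,
      Finset.sum_const, Finset.card_range, ← Nat.cast_smul_eq_nsmul ℝ, smul_smul]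
    push_cast
    rw [one_div, inv_mul_cancel₀ hK.ne', one_smul]
  have hmul := mul_le_mul_of_nonneg_left hsum (one_div_pos.2 hK).le
  rw [Finset.sum_add_distrib, Finset.sum_sub_distrib, Finset.sum_const, Finset.card_range,
    nsmul_eq_mul, mul_add, mul_sub, ← hinner] at hmul
  push_cast at hmul
  rw [← mul_assoc, one_div_mul_cancel hK.ne', one_mul] at hmul
  have e : 1 / (2 * ((K : ℝ) + 1)) = 1 / ((K : ℝ) + 1) * (1 / 2) := by field_simp
  rw [e, mul_assoc]
  linarith
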